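/- Let $(R,\mathfrak m)$ be a (commutative) local Noetherian domain of Krull dimension one with residue field $k=R/\mathfrak m$, where $k$ may be finite or infinite. Let $$e(R)=\lim_{n\to\infty}\frac{\operatorname{length}_R(R/\mathfrak m^n)}{n}$$ be the multiplicity of $R$. If $e(R)\le |k|$, then every ideal $I$ of $R$ has a principal reduction; that is, there are a principal ideal $J\subseteq I$ and an integer $n>0$ such that $I^{n+1}=JI^n$. -/

import Mathlib

open scoped ENNReal Nat

/-- `J` is a reduction of `I`: `J` is a subideal of `I` with `I ^ (n + 1) = J * I ^ n` for some
`n > 0`. -/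
def Ideal.IsReduction {R : Type*} [CommRing R] (J I : Ideal R) : Prop :=
  J ≤ I ∧ ∃ n : ℕ, 0 < n ∧ I ^ (n + 1) = J * I ^ n

/-- The Krull dimension of a ring as a natural number; for a nontrivial ring of finite Krull
dimension (such as a Noetherian local ring) this is `ringKrullDim R`. -/
noncomputable def krullDimNat (R : Type*) [CommRing R] : ℕ :=
  ((ringKrullDim R).unbotD 0).toNat

/-- The (Hilbert-Samuel) multiplicity of a local ring `(R, 𝔪)` of dimension `d`, namely the limit of
`d! * length_R (R / 𝔪 ^ n) / n ^ d` as `n → ∞`. For a Noetherian local ring this sequence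
converges (the length is eventually a polynomial of degree `d` in `n`), so its upper limit, taken
in `[0, ∞]`, is its limit. -/
noncomputable def IsLocalRing.hilbertSamuelMultiplicity (R : Type*) [CommRing R] [IsLocalRing R] :
    ℝ≥0∞ :=
  Filter.limsup
    (fun n : ℕ ↦ ((krullDimNat R)! : ℝ≥0∞) *
      ((Module.length R (R ⧸ IsLocalRing.maximalIdeal R ^ n) : ℕ∞) : ℝ≥0∞) /
        (n : ℝ≥0∞) ^ krullDimNat R)
    Filter.atTop

/-! Let B be the integral closure of R in its fraction field K. By Krull-Akizuki B is Dedekind, and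
its finitely many maximal ideals p all lie over 𝔪. For I ≠ 0, an x in I generates IB once it avoids
every pIB. The traces of the pIB on I are proper R-submodules, and at most |k| proper submodules
cannot cover a module over R, so such an x exists if B has at most e(R) ≤ |k| maximal ideals. Then
all y/x with y in I are integral over R, so x generates a reduction of I. To bound r maximal ideals
of B by e(R), contract them to a finite subalgebra S that still separates them: S/𝔪ⁿS has length at
least nr, while S/R has finite length, so R/𝔪ⁿ has length at least nr minus a constant. -/

namespace Module

/-! ### Length estimates in dimension one -/

variable {R : Type*} [CommRing R]

/-- A bound on the lengths of the finitely generated submodules bounds the length of the module. -/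
lemma length_le_of_forall_fg {P : Type*} [AddCommGroup P] [Module R P] {l : ℕ∞}
    (h : ∀ N : Submodule R P, N.FG → length R N ≤ l) : length R P ≤ l := by
  rw [← WithBot.coe_le_coe, coe_length, Order.krullDim, iSup_le_iff]
  intro p
  have hx (i : Fin p.length) : ∃ x, x ∈ p i.succ ∧ x ∉ p i.castSucc :=
    SetLike.exists_of_lt (p.step i)
  choose x hx hx' using hx
  refine le_trans ?_ (WithBot.coe_le_coe.mpr
    (h (Submodule.span R (Set.range x)) (Submodule.fg_span (Set.finite_range x))))
  rw [coe_length]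
  let q : LTSeries (Submodule R (Submodule.span R (Set.range x))) :=
    { length := p.length
      toFun := fun i ↦ (p i).comap (Submodule.subtype _)
      step := fun i ↦ by
        refine lt_of_le_of_ne (Submodule.comap_mono (p.step i).le) fun e ↦ hx' i ?_
        have : (⟨x i, Submodule.subset_span ⟨i, rfl⟩⟩ : Submodule.span R (Set.range x)) ∈
          (p i.succ).comap (Submodule.subtype _) := hx i
        rw [← e] at this
        exact this }
  exact Order.LTSeries.length_le_krullDim q

lemma length_le_add_length_quotient_range {M N : Type*} [AddCommGroup M] [Module R M]
    [AddCommGroup N] [Module R N] (f : M →ₗ[R] N) :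
    length R N ≤ length R M + length R (N ⧸ LinearMap.range f) := by
  rw [length_eq_add_of_exact (LinearMap.range f).subtype (LinearMap.range f).mkQ
    (Submodule.subtype_injective _) (Submodule.mkQ_surjective _)
    (LinearMap.exact_subtype_mkQ _)]
  gcongr
  exact length_le_of_surjective f.rangeRestrict f.surjective_rangeRestrict

variable [IsDomain R] [IsNoetherianRing R] [Ring.KrullDimLE 1 R]

lemma length_quotient_ne_top_of_ne_bot {I : Ideal R} (hI : I ≠ ⊥) : length R (R ⧸ I) ≠ ⊤ := by
  obtain ⟨b, hb, hb0⟩ := I.ne_bot_iff.mp hI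
  have h := length_ne_top_iff.mpr
    (isFiniteLength_quotient_span_singleton R (mem_nonZeroDivisors_of_ne_zero hb0))
  refine ne_top_of_le_ne_top h
    (length_le_of_surjective (Submodule.factor ((Ideal.span_singleton_le_iff_mem I).mpr hb)) ?_)
  exact Submodule.factor_surjective _

/-- For a module `T` isomorphic to an ideal, `T / a T` is at most as long as `R / a R`. -/
lemma length_quotient_range_lsmul_le {T : Type*} [AddCommGroup T] [Module R T]
    (g : T →ₗ[R] R) (hg : Function.Injective g) {a : R} (ha : a ≠ 0) :
    length R (T ⧸ LinearMap.range (LinearMap.lsmul R T a)) ≤ length R (R ⧸ Ideal.span {a}) := by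
  by_cases hT : LinearMap.range g = ⊥
  · have : Subsingleton T := by
      refine ⟨fun x y ↦ hg ?_⟩
      rw [LinearMap.range_eq_bot.mp hT]; rfl
    simp
  have hfin := length_quotient_ne_top_of_ne_bot hT
  set I : Ideal R := LinearMap.range g
  -- The length of R/aI is computed through I and through aR; since I/aI ≅ T/aT and aR/aI ≅ R/I, the
  -- finite length of R/I cancels.
  let aI : Ideal R := Submodule.map (LinearMap.lsmul R R a) I
  have haI : aI ≤ I := by
    rintro _ ⟨y, hy, rfl⟩
    exact I.mul_mem_left a hy
  have haI' : aI ≤ Ideal.span {a} := by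
    rintro _ ⟨y, hy, rfl⟩
    exact Ideal.mem_span_singleton.mpr ⟨y, rfl⟩
  have h1 : LinearMap.range (LinearMap.lsmul R T a) ≤ Submodule.comap g aI := by
    rintro _ ⟨t, rfl⟩
    exact ⟨g t, ⟨t, rfl⟩, (g.map_smul a t).symm⟩
  have e1 : length R (R ⧸ aI) =
      length R (T ⧸ LinearMap.range (LinearMap.lsmul R T a)) + length R (R ⧸ I) := by
    refine length_eq_add_of_exact (Submodule.mapQ _ aI g h1) (Submodule.factor haI) ?_
      (Submodule.factor_surjective _) ?_
    · rw [injective_iff_map_eq_zero]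
      intro t
      obtain ⟨t, rfl⟩ := Submodule.mkQ_surjective _ t
      simp only [Submodule.mkQ_apply, Submodule.mapQ_apply, Submodule.Quotient.mk_eq_zero]
      rintro ⟨_, ⟨t', rfl⟩, h⟩
      exact ⟨t', hg (by simpa using h)⟩
    · intro r
      obtain ⟨r, rfl⟩ := Submodule.mkQ_surjective _ r
      change (Submodule.Quotient.mk r : R ⧸ I) = 0 ↔ _
      rw [Submodule.Quotient.mk_eq_zero]
      constructor
      · rintro ⟨t, rfl⟩
        exact ⟨Submodule.Quotient.mk t, rfl⟩
      · rintro ⟨t, ht⟩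
        obtain ⟨t, rfl⟩ := Submodule.mkQ_surjective _ t
        rw [Submodule.mkQ_apply, Submodule.mapQ_apply, Submodule.mkQ_apply, Submodule.Quotient.eq] at ht
        simpa using I.sub_mem (⟨t, rfl⟩ : g t ∈ I) (haI ht)
  have e2 : length R (R ⧸ aI) = length R (R ⧸ I) + length R (R ⧸ Ideal.span {a}) := by
    refine length_eq_add_of_exact
      (Submodule.mapQ I aI (LinearMap.lsmul R R a) (Submodule.le_comap_map _ _))
      (Submodule.factor haI') ?_ (Submodule.factor_surjective _) ?_
    · rw [injective_iff_map_eq_zero]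
      intro t
      obtain ⟨t, rfl⟩ := Submodule.mkQ_surjective _ t
      simp only [Submodule.mkQ_apply, Submodule.mapQ_apply, Submodule.Quotient.mk_eq_zero]
      rintro ⟨t', ht', h⟩
      rwa [← mul_left_cancel₀ ha (by simpa using h : a * t' = a * t)]
    · intro r
      obtain ⟨r, rfl⟩ := Submodule.mkQ_surjective _ r
      change (Submodule.Quotient.mk r : R ⧸ Ideal.span {a}) = 0 ↔ _
      rw [Submodule.Quotient.mk_eq_zero]
      constructor
      · intro h
        obtain ⟨t, rfl⟩ := Ideal.mem_span_singleton.mp h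
        exact ⟨Submodule.Quotient.mk t, rfl⟩
      · rintro ⟨t, ht⟩
        obtain ⟨t, rfl⟩ := Submodule.mkQ_surjective _ t
        rw [Submodule.mkQ_apply, Submodule.mapQ_apply, Submodule.mkQ_apply, Submodule.Quotient.eq] at ht
        simpa using (Ideal.span {a}).sub_mem
          (Ideal.mem_span_singleton.mpr ⟨t, rfl⟩ : a * t ∈ Ideal.span {a}) (haI' ht)
  rw [e1, add_comm] at e2
  exact (ENat.add_right_injective_of_ne_top hfin e2).le

end Module

/-- A finitely generated module embedded in the fraction field is isomorphic to an ideal. -/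
lemma exists_smul_eq_algebraMap_of_injective {R K : Type*} [CommRing R] [IsDomain R] [Field K]
    [Algebra R K] [IsFractionRing R K] {T : Type*} [AddCommGroup T] [Module R T] [Module.Finite R T]
    (j : T →ₗ[R] K) (hj : Function.Injective j) :
    ∃ (d : R) (g : T →ₗ[R] R), d ≠ 0 ∧ Function.Injective g ∧
      ∀ t, algebraMap R K (g t) = d • j t := by
  classical
  obtain ⟨s, hs⟩ := Module.Finite.fg_top (R := R) (M := T)
  obtain ⟨d, hd⟩ := IsLocalization.exist_integer_multiples (nonZeroDivisors R) s j
  have hd0 : (d : R) ≠ 0 := nonZeroDivisors.ne_zero d.2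
  have hmem (t : T) : (d : R) • j t ∈ LinearMap.range (Algebra.linearMap R K) := by
    have : (⊤ : Submodule R T) ≤
        (LinearMap.range (Algebra.linearMap R K)).comap ((d : R) • j) := by
      rw [← hs, Submodule.span_le]
      intro t ht
      obtain ⟨r, hr⟩ := hd t ht
      exact ⟨r, hr⟩
    exact this (Submodule.mem_top (x := t))
  let e := LinearEquiv.ofInjective (Algebra.linearMap R K) (IsFractionRing.injective R K)
  let f : T →ₗ[R] LinearMap.range (Algebra.linearMap R K) :=
    LinearMap.codRestrict _ ((d : R) • j) hmem
  have hf : ∀ t, algebraMap R K ((e.symm.toLinearMap ∘ₗ f) t) = (d : R) • j t := fun t ↦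
    congrArg Subtype.val (e.apply_symm_apply (f t))
  refine ⟨d, e.symm.toLinearMap ∘ₗ f, hd0, fun x y h ↦ hj ?_, hf⟩
  have h2 : (d : R) • j x = (d : R) • j y := by rw [← hf, ← hf, h]
  rw [Algebra.smul_def, Algebra.smul_def] at h2
  exact mul_left_cancel₀ (by simp [hd0]) h2

/-! ### Krull-Akizuki -/

section KrullAkizuki

variable {R K : Type*} [CommRing R] [IsDomain R] [IsNoetherianRing R] [Ring.KrullDimLE 1 R]
  [Field K] [Algebra R K] [IsFractionRing R K]

/-- B need not be finite over R, but a finitely generated submodule of B/aB comes from a finitely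
generated T ⊆ B, which is isomorphic to an ideal. -/
lemma Subalgebra.length_quotient_range_lsmul_le (B : Subalgebra R K) {a : R} (ha : a ≠ 0) :
    Module.length R (B ⧸ LinearMap.range (LinearMap.lsmul R B a)) ≤
      Module.length R (R ⧸ Ideal.span {a}) := by
  set Q := LinearMap.range (LinearMap.lsmul R B a)
  refine Module.length_le_of_forall_fg fun N ⟨s, hs⟩ ↦ ?_
  let σ := Function.surjInv (Submodule.mkQ_surjective Q)
  let T : Submodule R B := Submodule.span R (σ '' s)
  have : Module.Finite R T :=
    Module.Finite.iff_fg.mpr (Submodule.fg_span (s.finite_toSet.image σ))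
  obtain ⟨d, g, -, hg, -⟩ := exists_smul_eq_algebraMap_of_injective (K := K)
    (B.val.toLinearMap ∘ₗ T.subtype) (Subtype.val_injective.comp T.subtype_injective)
  refine le_trans ?_ (Module.length_quotient_range_lsmul_le g hg ha)
  let f := Submodule.mapQ (LinearMap.range (LinearMap.lsmul R T a)) Q T.subtype (by
    rintro _ ⟨t, rfl⟩
    exact ⟨t, rfl⟩)
  have hN : N ≤ LinearMap.range f := by
    rw [← hs, Submodule.span_le]
    intro x hx
    exact ⟨Submodule.Quotient.mk ⟨σ x, Submodule.subset_span ⟨x, hx, rfl⟩⟩,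
      Function.surjInv_eq (Submodule.mkQ_surjective Q) x⟩
  exact (Module.length_le_of_injective (Submodule.inclusion hN)
    (Submodule.inclusion_injective hN)).trans
    (Module.length_le_of_surjective f.rangeRestrict f.surjective_rangeRestrict)

/-- A subring of the fraction field integral over a one-dimensional Noetherian domain is
Noetherian: a case of the Krull-Akizuki theorem. -/
lemma Subalgebra.isNoetherianRing_of_isIntegral (B : Subalgebra R K) [Algebra.IsIntegral R B] :
    IsNoetherianRing B := by
  rw [isNoetherianRing_iff_ideal_fg]
  intro J
  by_cases hJ : J = ⊥
  · rw [hJ]; exact Submodule.fg_bot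
  obtain ⟨b, hb, hb0⟩ := J.ne_bot_iff.mp hJ
  obtain ⟨a, haJ, ha⟩ := (Ideal.comap (algebraMap R B) J).ne_bot_iff.mp
    (Ideal.comap_ne_bot_of_integral_mem hb0 hb (Algebra.IsIntegral.isIntegral b))
  let A : Ideal B := Ideal.span {algebraMap R B a}
  have hA : A.restrictScalars R = LinearMap.range (LinearMap.lsmul R B a) := by
    ext x
    simp only [Submodule.restrictScalars_mem, A, Ideal.mem_span_singleton', LinearMap.mem_range,
      LinearMap.lsmul_apply, Algebra.smul_def, mul_comm]
  have hl : Module.length R (B ⧸ A.restrictScalars R) ≠ ⊤ := by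
    rw [hA]
    exact ne_top_of_le_ne_top (Module.length_quotient_ne_top_of_ne_bot (by simpa using ha))
      (B.length_quotient_range_lsmul_le ha)
  have h1 := (isFiniteLength_iff_isNoetherian_isArtinian.mp (Module.length_ne_top_iff.mp hl)).1
  have h2 : IsNoetherian R (B ⧸ A) :=
    isNoetherian_of_linearEquiv (Submodule.Quotient.restrictScalarsEquiv R A)
  have h3 : IsNoetherian B (B ⧸ A) := isNoetherian_of_tower R h2
  refine Submodule.fg_of_fg_map_of_fg_inf_ker A.mkQ (IsNoetherian.noetherian _) ?_
  have hAJ : A ≤ J := (Ideal.span_singleton_le_iff_mem J).mpr haJ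
  rw [Submodule.ker_mkQ, inf_eq_right.mpr hAJ]
  exact ⟨{algebraMap R B a}, by simp [A]⟩

lemma integralClosure.isDedekindDomain_of_krullDimLE_one :
    IsDedekindDomain (integralClosure R K) := by
  have : IsNoetherianRing (integralClosure R K) := Subalgebra.isNoetherianRing_of_isIntegral _
  have : Ring.DimensionLEOne R := ⟨fun {p} h0 hp ↦ hp.isMaximal_of_ne_bot h0⟩
  have : IsIntegrallyClosed (integralClosure R K) :=
    integralClosure.isIntegrallyClosedOfFiniteExtension K
  have : IsDedekindRing (integralClosure R K) := {}
  infer_instance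

end KrullAkizuki

/-! ### Covering a module by submodules -/

open scoped Pointwise in
/-- A module over a local ring is not the union of at most `|k|` proper submodules. -/
lemma IsLocalRing.exists_forall_notMem_submodule {R : Type*} [CommRing R] [IsLocalRing R]
    {M : Type*} [AddCommGroup M] [Module R M] {ι : Type*} (s : Finset ι) (N : ι → Submodule R M)
    (hN : ∀ i ∈ s, N i ≠ ⊤) (hs : (s.card : ℕ∞) ≤ ENat.card (ResidueField R)) :
    ∃ x, ∀ i ∈ s, x ∉ N i := by
  classical
  by_contra! hcov
  have hcovers : ⋃ i ∈ s, (0 : M) +ᵥ ((N i).toAddSubgroup : Set M) = Set.univ := by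
    rw [Set.eq_univ_iff_forall]
    intro x
    obtain ⟨i, hi, hx⟩ := hcov x
    simp only [zero_vadd, Set.mem_iUnion]
    exact ⟨i, hi, hx⟩
  have key (i) (hi : i ∈ s) (hfi : (N i).toAddSubgroup.FiniteIndex) :
      Finite (ResidueField R) ∧ Nat.card (ResidueField R) ≤ (N i).toAddSubgroup.index := by
    have : Finite (M ⧸ N i) := AddSubgroup.finite_quotient_of_finiteIndex (H := (N i).toAddSubgroup)
    have : Nontrivial (M ⧸ N i) := Submodule.Quotient.nontrivial_iff.mpr (hN i hi)
    obtain ⟨y, hy⟩ := exists_ne (0 : M ⧸ N i)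
    let σ := Function.surjInv (residue_surjective (R := R))
    have hσ (c) : residue R (σ c) = c := Function.surjInv_eq residue_surjective c
    have hinj : Function.Injective fun c ↦ σ c • y := by
      intro c c' h
      by_contra hne
      have hu : IsUnit (σ c - σ c') := by
        rw [← residue_ne_zero_iff_isUnit, map_sub, hσ, hσ]
        exact sub_ne_zero.mpr hne
      refine hy (hu.smul_eq_zero.mp ?_)
      rw [sub_smul, sub_eq_zero]
      exact h
    exact ⟨Finite.of_injective _ hinj, Nat.card_le_card_of_injective _ hinj⟩
  -- B. H. Neumann: the inverse indices in a cover sum to at least 1, infinite index counting as 0.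
  -- Each finite index is at least |k|, so the sum is exactly 1; then the finite-index members are
  -- disjoint, yet all contain 0.
  have h1 := AddSubgroup.one_le_sum_inv_index_of_leftCoset_cover hcovers
  set F := s.filter fun i ↦ (N i).toAddSubgroup.FiniteIndex with hF
  have hsum : ∑ i ∈ s, ((N i).toAddSubgroup.index : ℚ)⁻¹ =
      ∑ i ∈ F, ((N i).toAddSubgroup.index : ℚ)⁻¹ := by
    rw [hF, Finset.sum_filter]
    refine Finset.sum_congr rfl fun i _ ↦ ?_
    split_ifs with h
    · rfl
    · simpa using AddSubgroup.not_finiteIndex_iff.mp h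
  have hne : F.Nonempty := by
    rw [Finset.nonempty_iff_ne_empty]
    intro h
    rw [hsum, h, Finset.sum_empty] at h1
    norm_num at h1
  obtain ⟨i₀, hi₀⟩ := hne
  obtain ⟨hi₀s, hi₀f⟩ := Finset.mem_filter.mp hi₀
  have hfin := (key i₀ hi₀s hi₀f).1
  have hq : 1 < Nat.card (ResidueField R) := Finite.one_lt_card
  set q := Nat.card (ResidueField R)
  have hq0 : (0 : ℚ) < q := by exact_mod_cast zero_lt_one.trans hq
  have hsq : s.card ≤ q := by
    rw [ENat.card_eq_coe_natCard] at hs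
    exact_mod_cast hs
  have hle : ∑ i ∈ F, ((N i).toAddSubgroup.index : ℚ)⁻¹ ≤ F.card * (q : ℚ)⁻¹ := by
    rw [← nsmul_eq_mul]
    refine Finset.sum_le_card_nsmul _ _ _ fun i hi ↦ ?_
    obtain ⟨his, hif⟩ := Finset.mem_filter.mp hi
    exact inv_anti₀ hq0 (by exact_mod_cast (key i his hif).2)
  rw [hsum] at h1
  have hqF : (q : ℚ) ≤ F.card := by
    have := h1.trans hle
    rwa [← div_eq_mul_inv, one_le_div hq0] at this
  have hFs : F.card ≤ s.card := Finset.card_filter_le _ _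
  have heq : ∑ i ∈ s, ((N i).toAddSubgroup.index : ℚ)⁻¹ = 1 := by
    rw [hsum]
    refine le_antisymm (hle.trans ?_) h1
    rw [← div_eq_mul_inv, div_le_one hq0]
    exact_mod_cast hFs.trans hsq
  have hdisj := AddSubgroup.pairwiseDisjoint_leftCoset_cover_of_sum_neg_index_eq_zero hcovers heq
  obtain ⟨i, hi, j, hj, hij⟩ := Finset.one_lt_card.mp (hq.trans_le (by exact_mod_cast hqF))
  have h0 (i) : (0 : M) ∈ (0 : M) +ᵥ ((N i).toAddSubgroup : Set M) := by simp
  exact Set.disjoint_left.mp (hdisj (by simpa [hF] using hi) (by simpa [hF] using hj) hij)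
    (h0 i) (h0 j)

/-! ### Reductions from principal extensions -/

/-- If `x ∈ I` generates the extension of `I` to an integral extension domain, then `x` generates a
reduction of `I`. -/
lemma Ideal.isReduction_span_singleton_of_dvd {R B : Type*} [CommRing R] [IsNoetherianRing R]
    [CommRing B] [IsDomain B] [Algebra R B] [FaithfulSMul R B] [Algebra.IsIntegral R B]
    {I : Ideal R} {x : R} (hx : x ∈ I) (hx0 : x ≠ 0)
    (h : ∀ y ∈ I, algebraMap R B x ∣ algebraMap R B y) :
    (Ideal.span {x}).IsReduction I := by
  refine ⟨(Ideal.span_singleton_le_iff_mem I).mpr hx, ?_⟩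
  have hφ : Function.Injective (algebraMap R B) := FaithfulSMul.algebraMap_injective R B
  have hφx : algebraMap R B x ≠ 0 := by simpa using hx0
  have h' (y : R) : ∃ b, y ∈ I → algebraMap R B y = algebraMap R B x * b := by
    by_cases hy : y ∈ I
    · obtain ⟨b, hb⟩ := h y hy
      exact ⟨b, fun _ ↦ hb⟩
    · exact ⟨0, fun h ↦ absurd h hy⟩
  choose b hb using h'
  obtain ⟨s, hs⟩ := IsNoetherian.noetherian I
  let A : Subalgebra R B := Algebra.adjoin R (b '' s)
  have hA : Module.Finite R A := Algebra.finite_adjoin_of_finite_of_isIntegral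
    (s.finite_toSet.image b) fun _ _ ↦ Algebra.IsIntegral.isIntegral _
  have hA1 : ∀ y ∈ I, ∃ a ∈ A, algebraMap R B x * a = algebraMap R B y := by
    suffices I ≤ Submodule.comap (Algebra.linearMap R B)
        (A.toSubmodule.map (LinearMap.mulLeft R (algebraMap R B x))) from fun y hy ↦ this hy
    rw [← hs, Submodule.span_le]
    intro y hy
    exact ⟨b y, Algebra.subset_adjoin ⟨y, hy, rfl⟩,
      (hb y (hs ▸ Submodule.subset_span hy)).symm⟩
  have hAn (n : ℕ) : ∀ z ∈ I ^ n, ∃ a ∈ A, algebraMap R B x ^ n * a = algebraMap R B z := by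
    suffices I ^ n ≤ Submodule.comap (Algebra.linearMap R B)
        (A.toSubmodule.map (LinearMap.mulLeft R (algebraMap R B x ^ n))) from fun y hy ↦ this hy
    induction n with
    | zero => exact fun z _ ↦ ⟨algebraMap R B z, A.algebraMap_mem z, by simp⟩
    | succ n ih =>
      rw [pow_succ, Ideal.mul_le]
      intro z hz y hy
      obtain ⟨a, ha, ha'⟩ := ih hz
      obtain ⟨c, hc, hc'⟩ := hA1 y hy
      refine ⟨a * c, A.mul_mem ha hc, ?_⟩
      simp only [LinearMap.mulLeft_apply, Algebra.linearMap_apply] at ha' ⊢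
      rw [map_mul, ← ha', ← hc', pow_succ]
      ring
  -- This is x⁻ⁿIⁿ inside the finite algebra A = R[I/x]; the chain increases, hence stabilizes.
  let M (n : ℕ) : Submodule R A := Submodule.comap
    (LinearMap.mulLeft R (algebraMap R B x ^ n) ∘ₗ A.val.toLinearMap)
    (Submodule.map (Algebra.linearMap R B) (I ^ n))
  have hM : Monotone M := by
    refine monotone_nat_of_le_succ fun n a ha ↦ ?_
    obtain ⟨z, hz, hza⟩ := ha
    refine ⟨x * z, by rw [pow_succ']; exact Ideal.mul_mem_mul hx hz, ?_⟩
    simp only [LinearMap.comp_apply, LinearMap.mulLeft_apply, Algebra.linearMap_apply] at hza ⊢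
    rw [map_mul, hza, pow_succ']
    ring
  obtain ⟨n, hn⟩ := monotone_stabilizes_iff_noetherian.mpr
    (inferInstance : IsNoetherian R A) ⟨M, hM⟩
  refine ⟨n + 1, n.succ_pos, le_antisymm (fun z hz ↦ ?_) ?_⟩
  · obtain ⟨a, ha, haz⟩ := hAn _ z hz
    have h1 : (⟨a, ha⟩ : A) ∈ M (n + 1 + 1) := ⟨z, hz, haz.symm⟩
    have h2 : M (n + 1) = M (n + 1 + 1) :=
      (hn (n + 1) (by lia)).symm.trans (hn (n + 1 + 1) (by lia))
    rw [← h2] at h1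
    obtain ⟨w, hw, hwa⟩ := h1
    have : z = x * w := by
      apply hφ
      simp only [LinearMap.comp_apply, LinearMap.mulLeft_apply, Algebra.linearMap_apply] at hwa
      rw [map_mul, hwa, ← haz, pow_succ' _ (n + 1), mul_assoc]
      rfl
    rw [this]
    exact Ideal.mul_mem_mul (Ideal.mem_span_singleton_self x) hw
  · rw [pow_succ' I (n + 1)]
    exact Ideal.mul_mono_left ((Ideal.span_singleton_le_iff_mem I).mpr hx)

/-! ### Multiplicity and the number of maximal ideals -/

lemma Ideal.mul_lt_of_ne_top {S : Type*} [CommRing S] [IsDomain S] {p Q : Ideal S}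
    (hp : p ≠ ⊤) (hQ : Q.FG) (hQ0 : Q ≠ ⊥) : p * Q < Q := by
  refine lt_of_le_not_ge Ideal.mul_le_right fun h ↦ hp ?_
  obtain ⟨r, hr, hr'⟩ := Submodule.exists_sub_one_mem_and_smul_eq_zero_of_fg_of_le_smul p Q hQ h
  obtain ⟨y, hy, hy0⟩ := Q.ne_bot_iff.mp hQ0
  have hr0 : r = 0 := (mul_eq_zero.mp (hr' y hy)).resolve_right hy0
  rw [Ideal.eq_top_iff_one]
  simpa [hr0] using hr

section

variable {R S : Type*} [CommRing R] [CommRing S] [IsDomain S] [IsNoetherianRing S] [Algebra R S]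

/-- By Nakayama each new factor strictly shrinks the product, so no unique factorization is needed.
-/
lemma Ideal.card_le_coheight_prod (M : Multiset (Ideal S)) (hM : ∀ p ∈ M, p ≠ ⊤ ∧ p ≠ ⊥) :
    (M.card : ℕ∞) ≤ Order.coheight (M.prod.restrictScalars R) := by
  induction M using Multiset.induction with
  | empty => simp
  | cons p M ih =>
    have hM' : ∀ p ∈ M, p ≠ ⊤ ∧ p ≠ ⊥ := fun q hq ↦ hM q (Multiset.mem_cons_of_mem hq)
    obtain ⟨hp, -⟩ := hM p (Multiset.mem_cons_self p M)
    have h0 : M.prod ≠ ⊥ := fun h ↦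
      (hM' _ (Multiset.prod_eq_zero_iff.mp h)).2 rfl
    have hlt := Ideal.mul_lt_of_ne_top hp (IsNoetherian.noetherian M.prod) h0
    rw [Multiset.card_cons, Multiset.prod_cons, Nat.cast_add, Nat.cast_one]
    refine le_trans ?_ (Order.coheight_add_one_le
      (show (p * M.prod).restrictScalars R < M.prod.restrictScalars R from hlt))
    gcongr
    exact ih hM'

/-- If `r` nonzero maximal ideals of `S` contain `I S`, then `S / I ^ n S` has length at least
`n r`. -/
lemma Ideal.mul_card_le_length_quotient_map_pow (I : Ideal R) (s : Finset (Ideal S))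
    (hs : ∀ p ∈ s, p.IsMaximal) (hs0 : ∀ p ∈ s, p ≠ ⊥) (hI : ∀ p ∈ s, I.map (algebraMap R S) ≤ p)
    (n : ℕ) : ((n * s.card : ℕ) : ℕ∞) ≤
      Module.length R (S ⧸ ((I ^ n).map (algebraMap R S)).restrictScalars R) := by
  rw [Module.length_quotient]
  have hprod : I.map (algebraMap R S) ≤ ∏ p ∈ s, p := by
    rw [Ideal.prod_eq_iInf_of_pairwise_isCoprime (J := fun p ↦ p)]
    · exact le_iInf₂ hI
    · intro p hp q hq hpq
      have := hs p hp
      have := hs q hq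
      exact Ideal.isCoprime_of_isMaximal hpq
  have hle : (I ^ n).map (algebraMap R S) ≤ (n • s.val).prod := by
    rw [Ideal.map_pow, Multiset.prod_nsmul, ← Multiset.map_id s.val]
    exact Ideal.pow_right_mono hprod n
  have h := Ideal.card_le_coheight_prod (R := R) (n • s.val) fun p hp ↦ by
    have hp' : p ∈ s := Multiset.mem_of_mem_nsmul hp
    exact ⟨(hs p hp').ne_top, hs0 p hp'⟩
  rw [Multiset.card_nsmul] at h
  exact h.trans (Order.coheight_anti hle)

end

/-- The cokernel of R/I → S/IS is a quotient of S/R, so the error term is the same for all powers of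
𝔪. -/
lemma Ideal.length_quotient_map_le {R S : Type*} [CommRing R] [CommRing S] [Algebra R S]
    (I : Ideal R) :
    Module.length R (S ⧸ (I.map (algebraMap R S)).restrictScalars R) ≤
      Module.length R (R ⧸ I) +
        Module.length R (S ⧸ LinearMap.range (Algebra.linearMap R S)) := by
  set U := (I.map (algebraMap R S)).restrictScalars R
  let f : (R ⧸ I) →ₗ[R] (S ⧸ U) := Submodule.mapQ I U (Algebra.linearMap R S) fun r hr ↦
    Ideal.mem_map_of_mem (algebraMap R S) hr
  refine (Module.length_le_add_length_quotient_range f).trans ?_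
  gcongr
  let g : (S ⧸ LinearMap.range (Algebra.linearMap R S)) →ₗ[R] ((S ⧸ U) ⧸ LinearMap.range f) :=
    Submodule.liftQ _ ((LinearMap.range f).mkQ ∘ₗ U.mkQ) (by
      rintro _ ⟨r, rfl⟩
      rw [LinearMap.mem_ker, LinearMap.comp_apply, Submodule.mkQ_apply,
        Submodule.Quotient.mk_eq_zero]
      exact ⟨Submodule.Quotient.mk r, rfl⟩)
  refine Module.length_le_of_surjective g fun y ↦ ?_
  obtain ⟨y, rfl⟩ := Submodule.mkQ_surjective _ y
  obtain ⟨y, rfl⟩ := Submodule.mkQ_surjective _ y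
  exact ⟨Submodule.Quotient.mk y, rfl⟩

/-- A finite birational extension of a one-dimensional Noetherian domain has finite colength. -/
lemma Module.length_quotient_range_linearMap_ne_top {R K S : Type*} [CommRing R] [IsDomain R]
    [IsNoetherianRing R] [Ring.KrullDimLE 1 R] [Field K] [Algebra R K] [IsFractionRing R K]
    [CommRing S] [Algebra R S] [Module.Finite R S] (j : S →ₐ[R] K) (hj : Function.Injective j) :
    Module.length R (S ⧸ LinearMap.range (Algebra.linearMap R S)) ≠ ⊤ := by
  obtain ⟨d, g, hd, hg, hgj⟩ := exists_smul_eq_algebraMap_of_injective (K := K) j.toLinearMap hj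
  -- The common denominator d gives dS ⊆ R, so S/R is a quotient of S/dS.
  have hle : LinearMap.range (LinearMap.lsmul R S d) ≤ LinearMap.range (Algebra.linearMap R S) := by
    rintro _ ⟨t, rfl⟩
    refine ⟨g t, hj ?_⟩
    rw [Algebra.linearMap_apply, AlgHom.commutes, hgj]
    simp
  refine ne_top_of_le_ne_top (Module.length_quotient_ne_top_of_ne_bot (R := R)
    (I := Ideal.span {d}) (by simpa using hd)) (le_trans ?_
    (Module.length_quotient_range_lsmul_le g hg hd))
  exact Module.length_le_of_surjective (Submodule.factor hle) (Submodule.factor_surjective _)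

lemma IsLocalRing.le_hilbertSamuelMultiplicity {R : Type*} [CommRing R] [IsLocalRing R]
    (hdim : ringKrullDim R = 1) {r : ℕ} {C : ℕ∞} (hC : C ≠ ⊤)
    (h : ∀ n : ℕ, ((n * r : ℕ) : ℕ∞) ≤ Module.length R (R ⧸ maximalIdeal R ^ n) + C) :
    (r : ℝ≥0∞) ≤ hilbertSamuelMultiplicity R := by
  have hk : krullDimNat R = 1 := by
    rw [krullDimNat, hdim]
    rfl
  rw [hilbertSamuelMultiplicity, hk]
  simp only [Nat.factorial_one, Nat.cast_one, one_mul, pow_one]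
  have hlim : Filter.Tendsto (fun n : ℕ ↦ (r : ℝ≥0∞) - (C : ℝ≥0∞) / (n : ℝ≥0∞)) Filter.atTop
      (nhds (r : ℝ≥0∞)) := by
    have h1 : Filter.Tendsto (fun n : ℕ ↦ (C : ℝ≥0∞) / (n : ℝ≥0∞)) Filter.atTop (nhds 0) := by
      rw [← ENNReal.div_top (a := (C : ℝ≥0∞))]
      exact ENNReal.Tendsto.const_div ENNReal.tendsto_nat_nhds_top
        (Or.inr (by simpa using hC))
    simpa using ENNReal.Tendsto.sub (tendsto_const_nhds (x := (r : ℝ≥0∞))) h1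
      (Or.inl (ENNReal.natCast_ne_top r))
  rw [← hlim.limsup_eq]
  refine Filter.limsup_le_limsup ?_
  filter_upwards [Filter.eventually_gt_atTop 0] with n hn
  rw [tsub_le_iff_right, ← ENNReal.add_div, ENNReal.le_div_iff_mul_le
    (Or.inl (by simpa using hn.ne')) (Or.inl (ENNReal.natCast_ne_top n)), mul_comm]
  have := ENat.toENNReal_le.mpr (h n)
  simpa using this

lemma IsLocalRing.comap_algebraMap_eq_maximalIdeal {R S : Type*} [CommRing R] [IsLocalRing R]
    [CommRing S] [Algebra R S] [Algebra.IsIntegral R S] (q : Ideal S) [q.IsMaximal] :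
    q.comap (algebraMap R S) = maximalIdeal R :=
  eq_maximalIdeal (Ideal.isMaximal_comap_of_isIntegral_of_isMaximal q)

lemma IsLocalRing.maximalIdeal_ne_bot_of_ringKrullDim_eq_one {R : Type*} [CommRing R]
    [IsLocalRing R] (hdim : ringKrullDim R = 1) :
    maximalIdeal R ≠ ⊥ := fun h ↦ by
  have := ringKrullDim_eq_zero_of_isField (isField_iff_maximalIdeal_eq.mpr h)
  rw [hdim] at this
  exact one_ne_zero this

lemma Ring.krullDimLE_one_of_ringKrullDim_eq_one {R : Type*} [CommRing R]
    (hdim : ringKrullDim R = 1) :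
    Ring.KrullDimLE 1 R := by
  rw [Ring.KrullDimLE, Order.krullDimLE_iff]
  exact hdim.le

/-- The multiplicity of a one-dimensional local domain bounds the number of maximal ideals of any
integral birational extension. -/
lemma Subalgebra.card_maximal_le_hilbertSamuelMultiplicity {R K : Type*} [CommRing R] [IsDomain R]
    [IsLocalRing R] [IsNoetherianRing R] [Field K] [Algebra R K] [IsFractionRing R K]
    (hdim : ringKrullDim R = 1) (B : Subalgebra R K) [Algebra.IsIntegral R B]
    (s : Finset (Ideal B)) (hs : ∀ p ∈ s, p.IsMaximal) :
    (s.card : ℝ≥0∞) ≤ IsLocalRing.hilbertSamuelMultiplicity R := by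
  classical
  have := Ring.krullDimLE_one_of_ringKrullDim_eq_one hdim
  have hb (p q : Ideal B) : ∃ b, p ∈ s → q ∈ s → p ≠ q → b ∈ p ∧ b ∉ q := by
    by_cases h : p ∈ s ∧ q ∈ s ∧ p ≠ q
    · obtain ⟨hp, hq, hpq⟩ := h
      have hle : ¬ p ≤ q := fun hle ↦ hpq ((hs p hp).eq_of_le (hs q hq).ne_top hle)
      obtain ⟨b, hb⟩ := SetLike.not_le_iff_exists.mp hle
      exact ⟨b, fun _ _ _ ↦ hb⟩
    · exact ⟨0, fun h1 h2 h3 ↦ absurd ⟨h1, h2, h3⟩ h⟩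
  choose b hb using hb
  -- Adjoining an element of p \ q for each pair keeps the contractions to S distinct.
  let t : Finset B := (s ×ˢ s).image fun x ↦ b x.1 x.2
  let S : Subalgebra R B := Algebra.adjoin R t
  have hS : Module.Finite R S := Algebra.finite_adjoin_of_finite_of_isIntegral
    t.finite_toSet fun _ _ ↦ Algebra.IsIntegral.isIntegral _
  have hSB : Algebra.IsIntegral S B := Algebra.IsIntegral.tower_top R
  have hSn : IsNoetherianRing S := isNoetherian_of_tower R inferInstance
  let s' : Finset (Ideal S) := s.image (Ideal.comap (algebraMap S B))
  have hcard : s'.card = s.card := by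
    refine Finset.card_image_of_injOn fun p hp q hq hpq ↦ ?_
    by_contra hne
    obtain ⟨h1, h2⟩ := hb p q hp hq hne
    have hbS : b p q ∈ S := Algebra.subset_adjoin
      (Finset.mem_coe.mpr (Finset.mem_image.mpr ⟨(p, q), Finset.mk_mem_product hp hq, rfl⟩))
    have h3 : (⟨b p q, hbS⟩ : S) ∈ Ideal.comap (algebraMap S B) p := h1
    exact h2 (show (⟨b p q, hbS⟩ : S) ∈ Ideal.comap (algebraMap S B) q from hpq ▸ h3)
  have hmax : ∀ p ∈ s', p.IsMaximal := by
    intro p hp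
    obtain ⟨q, hq, rfl⟩ := Finset.mem_image.mp hp
    have := hs q hq
    exact Ideal.isMaximal_comap_of_isIntegral_of_isMaximal q
  have hcomap : ∀ p ∈ s', p.comap (algebraMap R S) = IsLocalRing.maximalIdeal R := by
    intro p hp
    have := hmax p hp
    exact IsLocalRing.comap_algebraMap_eq_maximalIdeal p
  let j : S →ₐ[R] K := B.val.comp S.val
  have hj : Function.Injective j := Subtype.val_injective.comp Subtype.val_injective
  have hRS : Function.Injective (algebraMap R S) := by
    refine Function.Injective.of_comp (f := j) ?_
    rw [← AlgHom.coe_toRingHom, ← RingHom.coe_comp, AlgHom.comp_algebraMap]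
    exact IsFractionRing.injective R K
  refine IsLocalRing.le_hilbertSamuelMultiplicity hdim
    (Module.length_quotient_range_linearMap_ne_top j hj) fun n ↦ ?_
  rw [← hcard]
  refine (Ideal.mul_card_le_length_quotient_map_pow (IsLocalRing.maximalIdeal R) s' hmax ?_ ?_
    n).trans (Ideal.length_quotient_map_le _)
  · rintro p hp rfl
    refine IsLocalRing.maximalIdeal_ne_bot_of_ringKrullDim_eq_one hdim ?_
    rw [← hcomap _ hp, ← RingHom.ker_eq_comap_bot]
    exact (RingHom.injective_iff_ker_eq_bot _).mp hRS
  · intro p hp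
    rw [Ideal.map_le_iff_le_comap, hcomap p hp]

/-- Every maximal ideal of B lies over 𝔪, hence divides the nonzero ideal 𝔪B. -/
lemma IsLocalRing.finite_setOf_isMaximal {R B : Type*} [CommRing R] [IsLocalRing R] [CommRing B]
    [IsDedekindDomain B] [Algebra R B] [FaithfulSMul R B] [Algebra.IsIntegral R B]
    (hR : maximalIdeal R ≠ ⊥) :
    {p : Ideal B | p.IsMaximal}.Finite := by
  have hinj : Function.Injective (algebraMap R B) := FaithfulSMul.algebraMap_injective R B
  have hmap : (maximalIdeal R).map (algebraMap R B) ≠ 0 := by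
    intro h
    exact hR ((Ideal.map_eq_bot_iff_of_injective hinj).mp h)
  refine ((Ideal.finite_factors hmap).image
    IsDedekindDomain.HeightOneSpectrum.asIdeal).subset fun p (hp : p.IsMaximal) ↦ ?_
  have hle : (maximalIdeal R).map (algebraMap R B) ≤ p := by
    rw [Ideal.map_le_iff_le_comap, comap_algebraMap_eq_maximalIdeal p]
  refine ⟨⟨p, hp.isPrime, fun h0 ↦ hmap ?_⟩, Ideal.dvd_iff_le.mpr hle, rfl⟩
  rw [h0] at hle
  exact le_bot_iff.mp hle

/-- An element of `I` avoiding all `p I B` generates `I B`. -/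
lemma Ideal.span_singleton_eq_of_forall_notMem_mul {B : Type*} [CommRing B] [IsDedekindDomain B]
    {J : Ideal B} {x : B} (hx : x ∈ J) (h : ∀ p : Ideal B, p.IsMaximal → x ∉ p * J) :
    Ideal.span {x} = J := by
  obtain ⟨L, hL⟩ := Ideal.dvd_iff_le.mpr ((Ideal.span_singleton_le_iff_mem J).mpr hx)
  by_cases hL1 : L = ⊤
  · rw [hL, hL1, Ideal.mul_top]
  · obtain ⟨p, hp, hLp⟩ := Ideal.exists_le_maximal L hL1
    refine absurd ?_ (h p hp)
    have hxm : x ∈ J * L := hL ▸ Ideal.mem_span_singleton_self x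
    rw [mul_comm p]
    exact Ideal.mul_mono_right hLp hxm

/-! ### Choice of the generator -/

theorem corollary3p4 (R : Type*) [CommRing R] [IsDomain R] [IsLocalRing R] [IsNoetherianRing R]
    (hdim : ringKrullDim R = 1)
    (hmult : IsLocalRing.hilbertSamuelMultiplicity R ≤
      ((ENat.card (IsLocalRing.ResidueField R) : ℕ∞) : ℝ≥0∞)) :
    ∀ I : Ideal R, ∃ J : Ideal R, J.IsReduction I ∧ J.IsPrincipal := by
  intro I
  by_cases hI : I = ⊥
  · subst hI
    exact ⟨⊥, ⟨le_rfl, 1, one_pos, by simp⟩, inferInstance⟩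
  have := Ring.krullDimLE_one_of_ringKrullDim_eq_one hdim
  let K := FractionRing R
  let B := integralClosure R K
  have hB : IsDedekindDomain B := integralClosure.isDedekindDomain_of_krullDimLE_one
  have hinj : Function.Injective (algebraMap R B) := FaithfulSMul.algebraMap_injective R B
  let IB : Ideal B := I.map (algebraMap R B)
  have hIB : IB ≠ 0 := fun h ↦ hI ((Ideal.map_eq_bot_iff_of_injective hinj).mp h)
  have hfin : {p : Ideal B | p.IsMaximal}.Finite := IsLocalRing.finite_setOf_isMaximal
    (IsLocalRing.maximalIdeal_ne_bot_of_ringKrullDim_eq_one hdim)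
  have hcard : (hfin.toFinset.card : ℕ∞) ≤ ENat.card (IsLocalRing.ResidueField R) := by
    have := (B.card_maximal_le_hilbertSamuelMultiplicity hdim hfin.toFinset
      fun p hp ↦ hfin.mem_toFinset.mp hp).trans hmult
    rw [← ENat.toENNReal_le]
    simpa using this
  let N (p : Ideal B) : Submodule R I :=
    ((p * IB).restrictScalars R).comap (Algebra.linearMap R B ∘ₗ I.subtype)
  obtain ⟨⟨x, hxI⟩, hx⟩ := IsLocalRing.exists_forall_notMem_submodule hfin.toFinset N
    -- If the trace of pIB were all of I, then IB = pIB, and cancelling IB would give p = B.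
    (fun p hp htop ↦ by
      have hp' : p.IsMaximal := hfin.mem_toFinset.mp hp
      have hle : IB ≤ p * IB := by
        rw [Ideal.map_le_iff_le_comap]
        intro y hy
        have : (⟨y, hy⟩ : I) ∈ N p := htop ▸ Submodule.mem_top
        exact this
      have heq : p * IB = 1 * IB := by
        rw [one_mul]
        exact le_antisymm Ideal.mul_le_right hle
      exact hp'.ne_top ((mul_right_cancel₀ hIB heq).trans Ideal.one_eq_top)) hcard
  have hspan : Ideal.span {algebraMap R B x} = IB :=
    Ideal.span_singleton_eq_of_forall_notMem_mul (Ideal.mem_map_of_mem _ hxI)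
      fun p hp hmem ↦ hx p (hfin.mem_toFinset.mpr hp) hmem
  refine ⟨Ideal.span {x}, Ideal.isReduction_span_singleton_of_dvd (B := B) hxI ?_ fun y hy ↦ ?_,
    ⟨x, rfl⟩⟩
  · rintro rfl
    refine hIB ?_
    rw [← hspan]
    simp
  · rw [← Ideal.mem_span_singleton, hspan]
    exact Ideal.mem_map_of_mem _ hy
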